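/- Let $n,m\ge 0$ be integers, $F=(f_1,\dots,f_m):\mathbb{R}^n\to\mathbb{R}^m$ and $g:\mathbb{R}^m\to\mathbb{R}\cup\{+\infty\}$, with $\mathrm{dom}\,g=\{z: g(z)<+\infty\}$; norms are Euclidean and inequalities between vectors are coordinatewise. Let $J\subseteq\{1,\dots,m\}$ be such that $f_i$ is affine for every $i\notin J$ (for instance $J=\{i: f_i \text{ is not affine}\}$). Assume: 1. each $f_i$ is convex and continuously differentiable, and $\nabla f_i$ is locally Lipschitz continuous; 2. $g$ is convex, proper, lower semicontinuous, Lipschitz continuous on $\mathrm{dom}\,g$, and nondecreasing in its $i$-th argument for every $i\in J$; 3. $g\circ F$ is proper and has a minimizer; let $S=\mathrm{argmin}\, g\circ F$; 4. there is $\bar x\in\mathbb{R}^n$ with $F(\bar x)\in\mathrm{int}\,\mathrm{dom}\,g$. Let $\Gamma=\{\alpha\in\mathbb{R}^m_+ : \alpha_i>0 \text{ if } i\in J,\ \alpha_i=0 \text{ if } i\notin J\}$ and, for $\alpha\in\Gamma$, $x,y\in\mathbb{R}^n$, let $$H_\alpha(x,y)=F(x)+\nabla F(x)(y-x)+\frac{\alpha}{2}\|y-x\|^2\in\mathbb{R}^m,\qquad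 p_\alpha(x)=\mathrm{argmin}_{y\in\mathbb{R}^n}\ g(H_\alpha(x,y)).$$ Fix $x_0\in F^{-1}(\mathrm{dom}\,g)$, $\alpha_0\in\Gamma$ and $\eta>1$, and assume 5. $g\circ F$ is coercive and, for every $x\in F^{-1}(\mathrm{dom}\,g)$, $g(H_{\alpha_0}(x,\cdot))$ is coercive, where $h$ is called coercive if $h(y)\to+\infty$ as $\|y\|\to\infty$. The backtracking scheme iterates as follows for $k=0,1,2,\dots$: - Set $\tilde\alpha=\alpha_k$ and choose $\tilde x\in p_{\tilde\alpha}(x_k)$. - (Inner loop.) While $F(\tilde x)\le H_{\tilde\alpha}(x_k,\tilde x)$ fails: replace $\tilde\alpha_i$ by $\eta\tilde\alpha_i$ for exactly those $i$ with $f_i(\tilde x)>f_i(x_k)+\nabla f_i(x_k)^T(\tilde x-x_k)+\frac{\tilde\alpha_i}{2}\|\tilde x-x_k\|^2$, and then choose $\tilde x\in p_{\tilde\alpha}(x_k)$ for the new $\tilde\alpha$. When the loop ends, set $\alpha_{k+1}=\tilde\alpha$. - Set $x_{k+1}=x_k$ if $x_k\in p_{\alpha_{k+1}}(x_k)$, and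 $x_{k+1}=\tilde x$ otherwise. Then, whatever choices of minimizers are made: (i) the scheme is well defined and its inner loop always terminates: at every pair $(x_k,\alpha_k)$ that the scheme can reach, $x_k\in F^{-1}(\mathrm{dom}\,g)$, all the sets $p_{\tilde\alpha}(x_k)$ from which it has to choose a point are nonempty, and there is no infinite run of the inner loop; (ii) every sequence $(x_k)_{k\in\mathbb{N}}$ generated by the scheme converges to a point of $S$. -/

import Mathlib

open Set Filter Topology

noncomputable section

namespace Multiprox

/-- The Euclidean space `ℝᵈ`. -/
abbrev E (d : ℕ) : Type := EuclideanSpace ℝ (Fin d)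

/-- Effective domain of an extended-valued function. -/
def dom {d : ℕ} (h : E d → EReal) : Set (E d) := {z | h z < ⊤}

/-- `h` takes values in `ℝ ∪ {+∞}` and is not identically `+∞`. -/
def Proper {d : ℕ} (h : E d → EReal) : Prop := (∀ z, h z ≠ ⊥) ∧ (dom h).Nonempty

/-- Convexity of an extended-valued function: its epigraph is convex. -/
def ConvexFun {d : ℕ} (h : E d → EReal) : Prop :=
  Convex ℝ {p : E d × ℝ | h p.1 ≤ (p.2 : EReal)}

/-- `h` is (globally) Lipschitz continuous on its domain, for some constant. -/
def LipschitzOnDom {d : ℕ} (h : E d → EReal) : Prop :=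
  ∃ K : NNReal, LipschitzOnWith K (fun z => (h z).toReal) (dom h)

/-- `h` is nondecreasing in its `i`-th argument, the other arguments being fixed. -/
def NondecreasingIn {d : ℕ} (h : E d → EReal) (i : Fin d) : Prop :=
  ∀ z z' : E d, (∀ j, j ≠ i → z j = z' j) → z i ≤ z' i → h z ≤ h z'

/-- `h y → +∞` as `‖y‖ → ∞` (in `ℝᵈ`, leaving every compact set means `‖y‖ → ∞`). -/
def Coercive {d : ℕ} (h : E d → EReal) : Prop := Tendsto h (cocompact (E d)) (𝓝 ⊤)

/-- The set of (global) minimizers, with finite value. -/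
def argmin {d : ℕ} (h : E d → EReal) : Set (E d) := {y | h y < ⊤ ∧ ∀ y', h y ≤ h y'}

/-- A real-valued affine function on `ℝᵈ`. -/
def IsAffine {d : ℕ} (φ : E d → ℝ) : Prop := ∃ (a : E d) (b : ℝ), ∀ x, φ x = inner ℝ a x + b

variable {n m : ℕ}

/-- The `i`-th component of `F`. -/
def comp (F : E n → E m) (i : Fin m) : E n → ℝ := fun x => F x i

/-- The local model
`H_α(x, y) = F(x) + ∇F(x)(y - x) + (α / 2) ‖y - x‖²`, a vector of `ℝᵐ`. -/
def model (F : E n → E m) (α : Fin m → ℝ) (x y : E n) : E m :=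
  WithLp.toLp 2 fun i =>
    comp F i x + inner ℝ (gradient (comp F i) x) (y - x) + α i / 2 * ‖y - x‖ ^ 2

/-- The set `Γ` of admissible (inverse) step sizes: `α i > 0` for the indices `i ∈ J`, and
`α i = 0` for the other ones. -/
def stepSizes (J : Set (Fin m)) : Set (Fin m → ℝ) :=
  {α | (∀ i ∈ J, 0 < α i) ∧ ∀ i ∉ J, α i = 0}

/-- The solution set of the subproblem: minimizers of `y ↦ g (H_α(x, y))`. -/
def subSol (F : E n → E m) (g : E m → EReal) (α : Fin m → ℝ) (x : E n) : Set (E n) :=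
  argmin fun y => g (model F α x y)

/-- The acceptance test `F(y) ≤ H_α(x, y)` (coordinatewise) that ends the inner loop. -/
def Accepts (F : E n → E m) (x : E n) (α : Fin m → ℝ) (y : E n) : Prop :=
  ∀ i, F y i ≤ model F α x y i

/-- One pass over the step sizes: `α i` is multiplied by `η` for precisely those `i` at which
the model fails to majorize `F` at the trial point `y`. -/
def increase (F : E n → E m) (η : ℝ) (x : E n) (α : Fin m → ℝ) (y : E n) : Fin m → ℝ :=
  fun i => if model F α x y i < F y i then η * α i else α i

/-- State of the inner loop: current step sizes and current trial point. -/
abbrev InnerState (n m : ℕ) : Type := (Fin m → ℝ) × E n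

/-- Initialization of the inner loop at the point `x` with step sizes `α`. -/
def InnerInit (F : E n → E m) (g : E m → EReal) (x : E n) (α : Fin m → ℝ)
    (s : InnerState n m) : Prop :=
  s.1 = α ∧ s.2 ∈ subSol F g α x

/-- One execution of the body of the inner while-loop. It takes place only if the acceptance test
fails; the step sizes are increased, then a new trial point is picked among the minimizers. -/
def InnerStep (F : E n → E m) (g : E m → EReal) (η : ℝ) (x : E n)
    (s s' : InnerState n m) : Prop :=
  ¬ Accepts F x s.1 s.2 ∧ s'.1 = increase F η x s.1 s.2 ∧ s'.2 ∈ subSol F g s'.1 x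

/-- One outer iteration `(x, α) ↦ (x', α')`: the inner loop is run from `α` until the trial
point is accepted, `α'` is the final vector of step sizes, and `x'` is `x` itself if `x` solves the
final subproblem, and the final trial point otherwise. -/
def OuterStep (F : E n → E m) (g : E m → EReal) (η : ℝ)
    (p p' : E n × (Fin m → ℝ)) : Prop :=
  ∃ s₀ s : InnerState n m,
    InnerInit F g p.1 p.2 s₀ ∧
    Relation.ReflTransGen (InnerStep F g η p.1) s₀ s ∧
    Accepts F p.1 s.1 s.2 ∧
    p'.2 = s.1 ∧
    (p.1 ∈ subSol F g p'.2 p.1 → p'.1 = p.1) ∧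
    (p.1 ∉ subSol F g p'.2 p.1 → p'.1 = s.2)

/-- `(x k, α k)` is a sequence generated by the backtracking scheme from `(x₀, α₀)`. -/
def IsGenerated (F : E n → E m) (g : E m → EReal) (η : ℝ) (x₀ : E n) (α₀ : Fin m → ℝ)
    (x : ℕ → E n) (α : ℕ → Fin m → ℝ) : Prop :=
  x 0 = x₀ ∧ α 0 = α₀ ∧ ∀ k, OuterStep F g η (x k, α k) (x (k + 1), α (k + 1))

end Multiprox

end

/-! ### Order structure and local models -/

namespace Multiprox

variable {n m : ℕ}

/-! The function `g` is monotone for the order `JLe`, in which the linearization `model F 0 x` lies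
below both `F` and every admissible model, and `F` lies below the model at an accepted point. Hence
accepted steps decrease `g ∘ F`. With the qualification condition and continuity of `g` inside its
domain, a decrease of the linearized objective is equivalent to a decrease of `g ∘ F` or of any
model, so the fixed points of the subproblem are the solutions (`mem_subSol_self_iff`).

Distances to solutions do not increase until a solution is hit (`mem_argmin_or_dist_le`). The
composite `g ∘ H_α` need not be strongly convex; instead the trial point is compared with the point
of its segment to a solution at which the quadratic terms cancel exactly.

A compactness argument bounds all trial points issued from a sublevel set
(`exists_norm_le_of_model_le`). The gradients are Lipschitz on that bounded region, so no coordinate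
above a uniform threshold is ever increased (`exists_threshold`). The sum of the `log (α i)` is thus
bounded and grows by at least `log η` at each rejection: inner loops stop and the step sizes are
eventually constant. For constant step sizes, Fejér monotonicity and the optimality of one cluster
point give convergence (`exists_tendsto_of_fixed_steps`). -/

/-- The standing assumptions on the composite problem `min g ∘ F`. -/
structure Problem (F : E n → E m) (g : E m → EReal) (J : Set (Fin m)) : Prop where
  smooth : ∀ i, ContDiff ℝ 1 (comp F i)
  convex : ∀ i, ConvexOn ℝ univ (comp F i)
  grad : ∀ i, LocallyLipschitz (gradient (comp F i))
  affine : ∀ i ∉ J, IsAffine (comp F i)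
  proper : Proper g
  cvx : ConvexFun g
  lsc : LowerSemicontinuous g
  lip : LipschitzOnDom g
  mono : ∀ i ∈ J, NondecreasingIn g i
  slater : ∃ xbar, F xbar ∈ interior (dom g)

/-- The coordinatewise order, with equality required outside `J`. -/
def JLe (J : Set (Fin m)) (z z' : E m) : Prop := ∀ i, z i ≤ z' i ∧ (i ∉ J → z i = z' i)

/-- Coordinates are replaced one at a time: monotonicity handles those in `J`, and the others do not
change. -/
lemma JLe.le_of_nondecreasingIn {g : E m → EReal} {J : Set (Fin m)}
    (hg : ∀ i ∈ J, NondecreasingIn g i) {z z' : E m} (h : JLe J z z') : g z ≤ g z' := by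
  classical
  have key : ∀ s : Finset (Fin m),
      g z ≤ g (WithLp.toLp 2 fun i => if i ∈ s then z' i else z i) := by
    intro s
    induction s using Finset.induction_on with
    | empty => simp
    | insert a s ha ih =>
      refine ih.trans ?_
      by_cases haJ : a ∈ J
      · refine hg a haJ _ _ (fun j hj => ?_) ?_
        · simp [hj]
        · simpa [ha] using (h a).1
      · refine le_of_eq (congrArg g ?_)
        ext j
        by_cases hj : j = a
        · subst hj
          simpa [ha] using (h j).2 haJ
        · simp [hj]
  simpa using key Finset.univ

lemma add_inner_le_of_convexOn {d : ℕ} {f : E d → ℝ} (hf : ConvexOn ℝ univ f) {v x : E d}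
    (hv : HasGradientAt f v x) (y : E d) : f x + inner ℝ v (y - x) ≤ f y := by
  have hc : ConvexOn ℝ univ (f ∘ AffineMap.lineMap (k := ℝ) x y) := by
    simpa using hf.comp_affineMap (AffineMap.lineMap (k := ℝ) x y)
  have hd : HasDerivAt (f ∘ AffineMap.lineMap (k := ℝ) x y) (inner ℝ v (y - x)) 0 := by
    have h1 : HasFDerivAt f (InnerProductSpace.toDual ℝ (E d) v)
        (AffineMap.lineMap (k := ℝ) x y (0 : ℝ)) := by
      simpa using hv.hasFDerivAt
    simpa using h1.comp_hasDerivAt (0 : ℝ)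
      (AffineMap.hasDerivAt_lineMap (a := x) (b := y) (x := (0 : ℝ)))
  have := hc.le_slope_of_hasDerivAt (mem_univ 0) (mem_univ 1) one_pos hd
  simp [slope] at this
  linarith

section Model

variable {F : E n → E m} {J : Set (Fin m)}

@[simp] lemma model_apply (α : Fin m → ℝ) (x y : E n) (i : Fin m) :
    model F α x y i =
      F x i + inner ℝ (gradient (comp F i) x) (y - x) + α i / 2 * ‖y - x‖ ^ 2 := rfl

@[simp] lemma model_self (α : Fin m → ℝ) (x : E n) : model F α x x = F x := by
  ext i; simp

lemma jLe_model_model {α β : Fin m → ℝ} (h : ∀ i, α i ≤ β i) (hJ : ∀ i ∉ J, α i = β i)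
    (x y : E n) : JLe J (model F α x y) (model F β x y) := by
  intro i
  refine ⟨?_, fun hi => by simp [hJ i hi]⟩
  have := mul_le_mul_of_nonneg_right (h i) (sq_nonneg ‖y - x‖)
  simp only [model_apply]
  linarith

/-- The exact convexity defect of the quadratic is kept; the Fejér estimate uses it with equality.
-/
lemma model_combo_apply (α : Fin m → ℝ) (x y z : E n) (t : ℝ) (i : Fin m) :
    model F α x ((1 - t) • y + t • z) i =
      (1 - t) * model F α x y i + t * model F α x z i
        - t * (1 - t) * (α i / 2) * ‖y - z‖ ^ 2 := by
  have h1 : (1 - t) • y + t • z - x = (1 - t) • (y - x) + t • (z - x) := by module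
  have h2 : y - z = (y - x) - (z - x) := by abel
  simp only [model_apply]
  rw [h1, h2]
  generalize y - x = u
  generalize z - x = v
  rw [norm_add_sq_real, norm_sub_sq_real, inner_add_right, norm_smul, norm_smul]
  simp only [inner_smul_left, inner_smul_right, mul_pow, Real.norm_eq_abs, sq_abs]
  simp
  ring

lemma jLe_model_combo {α : Fin m → ℝ} (hα : α ∈ stepSizes J) (x y z : E n) {t : ℝ}
    (h0 : 0 ≤ t) (h1 : t ≤ 1) :
    JLe J (model F α x ((1 - t) • y + t • z))
      ((1 - t) • model F α x y + t • model F α x z) := by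
  intro i
  have hi : ((1 - t) • model F α x y + t • model F α x z) i =
    (1 - t) * model F α x y i + t * model F α x z i := rfl
  rw [hi, model_combo_apply]
  by_cases hJ : i ∈ J
  · have := (hα.1 i hJ).le
    have : 0 ≤ t * (1 - t) * (α i / 2) * ‖y - z‖ ^ 2 := by
      have := sub_nonneg.2 h1
      positivity
    exact ⟨by linarith, fun h => absurd hJ h⟩
  · simp [hα.2 i hJ]

end Model

/-! ### Linearization and descent inside the domain -/

namespace Problem

variable {F : E n → E m} {g : E m → EReal} {J : Set (Fin m)}

lemma hasGradientAt (hp : Problem F g J) (i : Fin m) (x : E n) :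
    HasGradientAt (comp F i) (gradient (comp F i) x) x :=
  ((hp.smooth i).differentiable one_ne_zero x).hasGradientAt

lemma continuous_F (hp : Problem F g J) : Continuous F :=
  (PiLp.continuous_toLp 2 _).comp (continuous_pi fun i => (hp.smooth i).continuous)

lemma continuous_model (hp : Problem F g J) (α : Fin m → ℝ) :
    Continuous fun p : E n × E n => model F α p.1 p.2 := by
  refine (PiLp.continuous_toLp 2 _).comp (continuous_pi fun i => ?_)
  have h1 := (hp.smooth i).continuous
  have h2 := (hp.grad i).continuous
  fun_prop

/-- This is the gradient inequality for convex components, exact for the affine ones. -/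
lemma jLe_model_zero (hp : Problem F g J) (x y : E n) : JLe J (model F 0 x y) (F y) := by
  intro i
  refine ⟨?_, fun hi => ?_⟩
  · simpa [comp] using add_inner_le_of_convexOn (hp.convex i) (hp.hasGradientAt i x) y
  · obtain ⟨a, b, h⟩ := hp.affine i hi
    have hg : HasGradientAt (comp F i) a x := by
      rw [hasGradientAt_iff_hasFDerivAt, funext h]
      exact ((InnerProductSpace.toDual ℝ (E n) a).hasFDerivAt).add_const b
    have hx : F x i = inner ℝ a x + b := h x
    have hy : F y i = inner ℝ a y + b := h y
    simp [hg.gradient, hx, hy, inner_sub_right]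
    ring

lemma le_of_jLe (hp : Problem F g J) {z z' : E m} (h : JLe J z z') : g z ≤ g z' :=
  h.le_of_nondecreasingIn hp.mono

lemma exists_real (hp : Problem F g J) {z : E m} (hz : z ∈ dom g) : ∃ r : ℝ, g z = r :=
  ⟨(g z).toReal, (EReal.coe_toReal (ne_of_lt hz) (hp.proper.1 z)).symm⟩

lemma mem_dom_of_jLe (hp : Problem F g J) {z z' : E m} (h : JLe J z z') (hz : z' ∈ dom g) :
    z ∈ dom g :=
  (hp.le_of_jLe h).trans_lt hz

lemma combo_le (hp : Problem F g J) {z w : E m} {r s t : ℝ} (hz : g z ≤ r) (hw : g w ≤ s)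
    (h0 : 0 ≤ t) (h1 : t ≤ 1) :
    g ((1 - t) • z + t • w) ≤ (((1 - t) * r + t * s : ℝ) : EReal) :=
  hp.cvx (x := (z, r)) hz (y := (w, s)) hw (sub_nonneg.2 h1) h0 (by ring)

lemma convex_dom (hp : Problem F g J) : Convex ℝ (dom g) := by
  intro z hz w hw a b ha hb hab
  obtain ⟨r, hr⟩ := hp.exists_real hz
  obtain ⟨s, hs⟩ := hp.exists_real hw
  obtain rfl : a = 1 - b := by linarith
  exact (hp.combo_le hr.le hs.le hb (by linarith)).trans_lt (EReal.coe_lt_top _)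

/-- The domain is a lower set for `JLe`, so a neighbourhood of `z'` inside it can be translated to
`z`. -/
lemma mem_interior_of_jLe (hp : Problem F g J) {z z' : E m} (h : JLe J z z')
    (hz : z' ∈ interior (dom g)) : z ∈ interior (dom g) := by
  rw [mem_interior_iff_mem_nhds] at hz ⊢
  have hc : Tendsto (fun w : E m => w + (z' - z)) (𝓝 z) (𝓝 z') := by
    have : Continuous fun w : E m => w + (z' - z) := by fun_prop
    simpa using this.tendsto z
  filter_upwards [hc hz] with w hw
  refine hp.mem_dom_of_jLe (fun i => ?_) hw
  have : (w + (z' - z)) i = w i + (z' i - z i) := rfl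
  rw [this]
  exact ⟨by linarith [(h i).1], fun hi => by linarith [(h i).2 hi]⟩

/-- Lipschitz continuity on the domain gives upper semicontinuity at its interior points. -/
lemma eventually_lt (hp : Problem F g J) {z : E m} (hz : z ∈ interior (dom g)) {r : EReal}
    (hr : g z < r) : ∀ᶠ w in 𝓝 z, g w < r := by
  obtain ⟨K, hK⟩ := hp.lip
  have hn := mem_interior_iff_mem_nhds.1 hz
  obtain ⟨q, hq, hqr⟩ := EReal.lt_iff_exists_real_btwn.1 hr
  obtain ⟨a, ha⟩ := hp.exists_real (interior_subset hz)
  have hc := (hK.continuousOn.continuousAt hn).tendsto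
  have hlt : (g z).toReal < q := by
    rw [ha] at hq ⊢
    exact_mod_cast hq
  filter_upwards [hc.eventually (gt_mem_nhds hlt), hn] with w hw hwd
  obtain ⟨b, hb⟩ := hp.exists_real hwd
  rw [hb] at hw ⊢
  exact lt_trans (by exact_mod_cast hw) hqr

/-- The point `p` may lie on the boundary of the domain, but moving from it towards an interior
point enters the interior, and convexity makes the value drop. A moving target `ψ t` absorbs the
curvature of a model or of `F`. -/
lemma eventually_segment_lt (hp : Problem F g J) {p z : E m} (hpd : p ∈ dom g)
    (hz : z ∈ interior (dom g)) (hlt : g z < g p) {ψ : ℝ → E m}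
    (hψ : Tendsto ψ (𝓝[>] 0) (𝓝 z)) :
    ∀ᶠ t in 𝓝[>] (0 : ℝ), (1 - t) • p + t • ψ t ∈ interior (dom g) ∧
      g ((1 - t) • p + t • ψ t) < g p := by
  obtain ⟨c, hc⟩ := hp.exists_real hpd
  obtain ⟨r, hr, hrp⟩ := EReal.lt_iff_exists_real_btwn.1 hlt
  have hrc : r < c := by rw [hc] at hrp; exact_mod_cast hrp
  filter_upwards [hψ.eventually (hp.eventually_lt hz hr),
    hψ.eventually (isOpen_interior.mem_nhds hz), Ioo_mem_nhdsGT (zero_lt_one' ℝ)] with t h1 h2 ht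
  refine ⟨hp.convex_dom.combo_self_interior_mem_interior hpd h2 (sub_nonneg.2 ht.2.le) ht.1
    (by ring), ?_⟩
  refine (hp.combo_le hc.le h1.le ht.1.le ht.2.le).trans_lt ?_
  rw [hc]
  have := mul_lt_mul_of_pos_left hrc ht.1
  exact_mod_cast (by linarith : (1 - t) * c + t * r < c)

/-- Any decrease of the linearized objective can be achieved in the interior of the domain. -/
lemma exists_interior_lt (hp : Problem F g J) {x y : E n} (hx : F x ∈ dom g)
    (hlt : g (model F 0 x y) < g (F x)) :
    ∃ w, model F 0 x w ∈ interior (dom g) ∧ g (model F 0 x w) < g (F x) := by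
  obtain ⟨xbar, hbar⟩ := hp.slater
  have hb := hp.mem_interior_of_jLe (hp.jLe_model_zero x xbar) hbar
  have hyd : model F 0 x y ∈ dom g := hlt.trans hx
  obtain ⟨c, hc⟩ := hp.exists_real hx
  obtain ⟨a, ha⟩ := hp.exists_real hyd
  obtain ⟨b, hb'⟩ := hp.exists_real (interior_subset hb)
  have hac : a < c := by rw [ha, hc] at hlt; exact_mod_cast hlt
  -- The linearization is affine in its last argument, so a small move towards `xbar` reaches the
  -- interior while keeping the strict decrease.
  have hcomb : ∀ t : ℝ, model F 0 x ((1 - t) • y + t • xbar) =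
      (1 - t) • model F 0 x y + t • model F 0 x xbar := by
    intro t
    ext i
    rw [model_combo_apply]
    simp
  have hlim : Tendsto (fun t : ℝ => (1 - t) * a + t * b) (𝓝[>] 0) (𝓝 a) := by
    have : Continuous fun t : ℝ => (1 - t) * a + t * b := by fun_prop
    simpa using (this.tendsto 0).mono_left nhdsWithin_le_nhds
  obtain ⟨t, ht, htI⟩ := ((hlim.eventually (gt_mem_nhds hac)).and
    (Ioo_mem_nhdsGT (zero_lt_one' ℝ))).exists
  refine ⟨(1 - t) • y + t • xbar, ?_, ?_⟩ <;> rw [hcomb]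
  · exact hp.convex_dom.combo_self_interior_mem_interior hyd hb (sub_nonneg.2 htI.2.le) htI.1
      (by ring)
  · refine (hp.combo_le ha.le hb'.le htI.1.le htI.2.le).trans_lt ?_
    rw [hc]
    exact_mod_cast ht

lemma exists_model_lt (hp : Problem F g J) (α : Fin m → ℝ) {x y : E n} (hx : F x ∈ dom g)
    (hlt : g (model F 0 x y) < g (F x)) :
    ∃ w, model F α x w ∈ interior (dom g) ∧ g (model F α x w) < g (F x) := by
  obtain ⟨w, hw, hwlt⟩ := hp.exists_interior_lt hx hlt
  -- At `x + t • (w - x)` the quadratic term carries `t ^ 2`; one factor `t` is the segment weight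
  -- and the other stays in `ψ t`.
  let ψ : ℝ → E m := fun t => WithLp.toLp 2 fun i =>
    F x i + inner ℝ (gradient (comp F i) x) (w - x) + t * (α i / 2 * ‖w - x‖ ^ 2)
  have hψ : Tendsto ψ (𝓝[>] 0) (𝓝 (model F 0 x w)) := by
    have hc : Continuous ψ :=
      (PiLp.continuous_toLp 2 _).comp (continuous_pi fun i => by fun_prop)
    have h0 : ψ 0 = model F 0 x w := by
      ext i; simp [ψ]
    exact h0 ▸ (hc.tendsto 0).mono_left nhdsWithin_le_nhds
  obtain ⟨t, ht⟩ := (hp.eventually_segment_lt hx hw hwlt hψ).exists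
  have hE : model F α x (x + t • (w - x)) = (1 - t) • F x + t • ψ t := by
    ext i
    simp only [model_apply, add_sub_cancel_left, inner_smul_right, norm_smul, mul_pow,
      Real.norm_eq_abs, sq_abs, PiLp.add_apply, PiLp.smul_apply, smul_eq_mul, ψ]
    ring
  exact ⟨_, hE ▸ ht⟩

lemma exists_comp_lt (hp : Problem F g J) {x y : E n} (hx : F x ∈ dom g)
    (hlt : g (model F 0 x y) < g (F x)) : ∃ w, g (F w) < g (F x) := by
  obtain ⟨w, hw, hwlt⟩ := hp.exists_interior_lt hx hlt
  -- Difference quotients tend to the linearization and place `F (x + t • (w - x))` exactly on the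
  -- segment from `F x` to `ψ t`.
  let ψ : ℝ → E m := fun t => WithLp.toLp 2 fun i =>
    F x i + t⁻¹ * (F (x + t • (w - x)) i - F x i)
  have hψ : Tendsto ψ (𝓝[>] 0) (𝓝 (model F 0 x w)) := by
    refine ((PiLp.continuous_toLp 2 _).tendsto _).comp (tendsto_pi_nhds.2 fun i => ?_)
    have hd : HasDerivAt (fun t : ℝ => comp F i (x + t • (w - x)))
        (inner ℝ (gradient (comp F i) x) (w - x)) 0 := by
      have h1 : HasFDerivAt (comp F i) (InnerProductSpace.toDual ℝ (E n)
          (gradient (comp F i) x)) (x + (0 : ℝ) • (w - x)) := by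
        simpa using (hp.hasGradientAt i x).hasFDerivAt
      have h2 : HasDerivAt (fun t : ℝ => x + t • (w - x)) (w - x) 0 := by
        simpa using ((hasDerivAt_id (0 : ℝ)).smul_const (w - x)).const_add x
      exact h1.comp_hasDerivAt (0 : ℝ) h2
    have := (hd.tendsto_slope_zero_right).const_add (F x i)
    simpa [comp] using this
  obtain ⟨t, ht, ht0⟩ :=
    ((hp.eventually_segment_lt hx hw hwlt hψ).and self_mem_nhdsWithin).exists
  have hE : F (x + t • (w - x)) = (1 - t) • F x + t • ψ t := by
    ext i
    have h0 : t ≠ 0 := ne_of_gt ht0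
    simp only [PiLp.add_apply, PiLp.smul_apply, smul_eq_mul, ψ]
    field_simp
    ring
  exact ⟨_, hE ▸ ht.2⟩

lemma jLe_model_zero_model {α : Fin m → ℝ} (hα : α ∈ stepSizes J) (x y : E n) :
    JLe J (model F 0 x y) (model F α x y) := by
  refine jLe_model_model (fun i => ?_) (fun i hi => (hα.2 i hi).symm) x y
  by_cases hi : i ∈ J
  · exact (hα.1 i hi).le
  · exact (hα.2 i hi).ge

/-! ### Fixed points and Fejér monotonicity -/

/-- Fixed points of the subproblem are exactly the solutions of the composite problem. -/
lemma mem_subSol_self_iff (hp : Problem F g J) {α : Fin m → ℝ} (hα : α ∈ stepSizes J)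
    {x : E n} (hx : F x ∈ dom g) : x ∈ subSol F g α x ↔ x ∈ argmin fun x => g (F x) := by
  constructor
  · rintro ⟨-, h⟩
    refine ⟨hx, fun y => ?_⟩
    by_contra! hlt
    obtain ⟨w, -, hw⟩ := hp.exists_model_lt α hx
      ((hp.le_of_jLe (hp.jLe_model_zero x y)).trans_lt hlt)
    have := h w
    simp only [model_self] at this
    exact this.not_gt hw
  · rintro ⟨-, h⟩
    refine ⟨by simpa [dom] using hx, fun y => ?_⟩
    by_contra! hlt
    simp only [model_self] at hlt
    obtain ⟨w, hw⟩ := hp.exists_comp_lt hx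
      ((hp.le_of_jLe (jLe_model_zero_model hα x y)).trans_lt hlt)
    exact (h w).not_gt hw

lemma jLe_of_accepts (hp : Problem F g J) {α : Fin m → ℝ} (hα : α ∈ stepSizes J) {x y : E n}
    (h : Accepts F x α y) : JLe J (F y) (model F α x y) := fun i =>
  ⟨h i, fun hi => by rw [← (hp.jLe_model_zero x y i).2 hi]; simp [hα.2 i hi]⟩

lemma le_of_mem_subSol {α : Fin m → ℝ} {x y : E n} (hy : y ∈ subSol F g α x) :
    g (model F α x y) ≤ g (F x) := by
  simpa using hy.2 x

/-- An accepted trial point either solves the problem, or is at least as close to every solution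
as the current point. -/
lemma mem_argmin_or_dist_le (hp : Problem F g J) {α : Fin m → ℝ} (hα : α ∈ stepSizes J)
    {x y xs : E n} (hy : y ∈ subSol F g α x) (hacc : Accepts F x α y)
    (hs : xs ∈ argmin fun x => g (F x)) :
    (y ∈ argmin fun x => g (F x)) ∨ dist y xs ≤ dist x xs := by
  by_contra! hcon
  obtain ⟨hyS, hd⟩ := hcon
  rw [dist_comm x, dist_eq_norm, dist_eq_norm] at hd
  apply hyS
  obtain ⟨b, hb⟩ := hp.exists_real hs.1
  obtain ⟨a, ha⟩ := hp.exists_real hy.1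
  have hpos : 0 < ‖y - xs‖ := (norm_nonneg _).trans_lt hd
  -- With this weight the convexity defect between `y` and `xs` cancels the quadratic term of the
  -- model at `xs`, leaving the linearization there, which is below `F xs`.
  set t : ℝ := 1 - ‖xs - x‖ ^ 2 / ‖y - xs‖ ^ 2 with ht
  have hd' : ‖xs - x‖ ^ 2 < ‖y - xs‖ ^ 2 := pow_lt_pow_left₀ hd (norm_nonneg _) two_ne_zero
  have ht0 : 0 < t := by
    rw [ht, sub_pos, div_lt_one (by positivity)]
    exact hd'
  have ht1 : t ≤ 1 := by
    rw [ht]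
    have : 0 ≤ ‖xs - x‖ ^ 2 / ‖y - xs‖ ^ 2 := by positivity
    linarith
  have hmul : (1 - t) * ‖y - xs‖ ^ 2 = ‖xs - x‖ ^ 2 := by
    rw [ht]; field_simp; ring
  have hJ : JLe J (model F α x ((1 - t) • y + t • xs))
      ((1 - t) • model F α x y + t • F xs) := by
    intro i
    have e : model F α x ((1 - t) • y + t • xs) i =
        (1 - t) * model F α x y i + t * model F 0 x xs i := by
      rw [model_combo_apply]
      simp only [model_apply, Pi.zero_apply]
      linear_combination (-t * (α i / 2)) * hmul
    have h0 := hp.jLe_model_zero x xs i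
    rw [e]
    simp only [PiLp.add_apply, PiLp.smul_apply, smul_eq_mul]
    exact ⟨by have := mul_le_mul_of_nonneg_left h0.1 ht0.le; linarith,
      fun hi => by rw [h0.2 hi]⟩
  have hle : (a : EReal) ≤ (((1 - t) * a + t * b : ℝ) : EReal) :=
    calc (a : EReal) = g (model F α x y) := ha.symm
      _ ≤ g (model F α x ((1 - t) • y + t • xs)) := hy.2 _
      _ ≤ _ := hp.le_of_jLe hJ
      _ ≤ _ := hp.combo_le ha.le hb.le ht0.le ht1
  have hab : a ≤ b := by
    have : a ≤ (1 - t) * a + t * b := by exact_mod_cast hle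
    exact le_of_mul_le_mul_left (by linarith : t * a ≤ t * b) ht0
  have hyb : g (F y) ≤ g (F xs) :=
    calc g (F y) ≤ g (model F α x y) := hp.le_of_jLe (hp.jLe_of_accepts hα hacc)
      _ = a := ha
      _ ≤ b := by exact_mod_cast hab
      _ = g (F xs) := hb.symm
  exact ⟨hyb.trans_lt hs.1, fun w => hyb.trans (hs.2 w)⟩

end Problem

end Multiprox

/-! ### Existence of trial points and uniform bounds -/

namespace Multiprox

variable {n m : ℕ}

lemma Coercive.exists_norm_le {d : ℕ} {h : E d → EReal} (hh : Coercive h) (c : ℝ) :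
    ∃ R, ∀ y, h y ≤ c → ‖y‖ ≤ R := by
  have h1 : ∀ᶠ y in cocompact (E d), (c : EReal) < h y := hh.eventually (lt_mem_nhds (EReal.coe_lt_top c))
  obtain ⟨K, hK, hKs⟩ := mem_cocompact.1 h1
  obtain ⟨R, hR⟩ := hK.isBounded.subset_closedBall 0
  refine ⟨R, fun y hy => ?_⟩
  by_contra hcon
  have hyK : y ∈ Kᶜ := fun hmem => hcon (by simpa using hR hmem)
  exact (hKs hyK).not_ge hy

namespace Problem

variable {F : E n → E m} {g : E m → EReal} {J : Set (Fin m)}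

lemma lsc_comp (hp : Problem F g J) : LowerSemicontinuous fun x => g (F x) :=
  hp.lsc.comp hp.continuous_F

/-- Larger step parameters give larger models, so sublevel sets stay inside the bounded ones for
`α₀`. -/
lemma subSol_nonempty (hp : Problem F g J) {α₀ α : Fin m → ℝ} (h₀ : α₀ ∈ stepSizes J)
    (hα : α ∈ stepSizes J) (hle : ∀ i, α₀ i ≤ α i) {x : E n} (hx : F x ∈ dom g)
    (hc : Coercive fun y => g (model F α₀ x y)) : (subSol F g α x).Nonempty := by
  obtain ⟨c, hcx⟩ := hp.exists_real hx
  obtain ⟨R, hR⟩ := hc.exists_norm_le c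
  have hmono : ∀ y, g (model F α₀ x y) ≤ g (model F α x y) := fun y =>
    hp.le_of_jLe (jLe_model_model hle (fun i hi => by rw [h₀.2 i hi, hα.2 i hi]) x y)
  have hxR : x ∈ Metric.closedBall (0 : E n) R := by
    simpa using hR x (by simp [hcx])
  have hl : LowerSemicontinuous fun y => g (model F α x y) :=
    hp.lsc.comp ((hp.continuous_model α).comp (by fun_prop : Continuous fun y : E n => (x, y)))
  obtain ⟨y, -, hymin⟩ := LowerSemicontinuousOn.exists_isMinOn ⟨x, hxR⟩
    (isCompact_closedBall (0 : E n) R) (hl.lowerSemicontinuousOn _)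
  have hyx : g (model F α x y) ≤ g (F x) := by simpa using hymin hxR
  refine ⟨y, hyx.trans_lt hx, fun w => ?_⟩
  by_cases hw : w ∈ Metric.closedBall (0 : E n) R
  · exact hymin hw
  · refine hyx.trans ?_
    by_contra! hlt
    have := hR w ((hmono w).trans (hlt.le.trans hcx.le))
    exact hw (by simpa using this)

/-- Trial points remain in a bounded set as long as the current point stays in a sublevel set. -/
lemma exists_norm_le_of_model_le (hp : Problem F g J) {α₀ : Fin m → ℝ} (h₀ : α₀ ∈ stepSizes J)
    (hP : Coercive fun x => g (F x))
    (hH : ∀ x, F x ∈ dom g → Coercive fun y => g (model F α₀ x y)) (c : ℝ) :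
    ∃ R, ∀ x y, g (F x) ≤ c → g (model F α₀ x y) ≤ c → ‖y‖ ≤ R := by
  obtain ⟨R₀, hR₀⟩ := hP.exists_norm_le c
  by_contra! hcon
  choose x y hx hy hlarge using fun k : ℕ => hcon (k + R₀)
  have hN : ∀ k : ℕ, (k : ℝ) < ‖y k - x k‖ := fun k => by
    have h1 := hR₀ _ (hx k)
    have h2 := norm_sub_norm_le (y k) (x k)
    linarith [hlarge k]
  have hNpos : ∀ k, 0 < ‖y k - x k‖ := fun k => (Nat.cast_nonneg k).trans_lt (hN k)
  -- Limits of the centres and of the unit directions produce a whole ray in one sublevel set of the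
  -- model at `a`, against its coercivity.
  let d : ℕ → E n := fun k => ‖y k - x k‖⁻¹ • (y k - x k)
  have hd : ∀ k, ‖d k‖ = 1 := fun k => by
    simp only [d, norm_smul, norm_inv, norm_norm]
    exact inv_mul_cancel₀ (hNpos k).ne'
  have hcpt : IsCompact (Metric.closedBall (0 : E n) R₀ ×ˢ Metric.sphere (0 : E n) 1) :=
    (isCompact_closedBall _ _).prod (isCompact_sphere _ _)
  obtain ⟨⟨a, e⟩, hae, φ, hφ, hlim⟩ := hcpt.tendsto_subseq (x := fun k => (x k, d k))
    fun k => ⟨by simpa using hR₀ _ (hx k), by simpa using hd k⟩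
  have he : ‖e‖ = 1 := by simpa using hae.2
  have hxa : Tendsto (fun k => x (φ k)) atTop (𝓝 a) := (continuous_fst.tendsto _).comp hlim
  have hda : Tendsto (fun k => d (φ k)) atTop (𝓝 e) := (continuous_snd.tendsto _).comp hlim
  have haF : g (F a) ≤ c :=
    (hp.lsc_comp.isClosed_preimage c).mem_of_tendsto hxa (Eventually.of_forall fun k => hx _)
  have hray : ∀ T : ℝ, 0 ≤ T → g (model F α₀ a (a + T • e)) ≤ c := by
    intro T hT
    have ht : Tendsto (fun k => model F α₀ (x (φ k)) (x (φ k) + T • d (φ k))) atTop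
        (𝓝 (model F α₀ a (a + T • e))) :=
      ((hp.continuous_model α₀).tendsto (a, a + T • e)).comp
        (hxa.prodMk_nhds (hxa.add (hda.const_smul T)))
    refine (hp.lsc.isClosed_preimage c).mem_of_tendsto ht ?_
    filter_upwards [eventually_ge_atTop ⌈T⌉₊] with k hk
    have hTk : T ≤ ‖y (φ k) - x (φ k)‖ := by
      have h1 : (⌈T⌉₊ : ℝ) ≤ φ k := by exact_mod_cast hk.trans (hφ.id_le k)
      linarith [Nat.le_ceil T, hN (φ k)]
    set N := ‖y (φ k) - x (φ k)‖ with hNdef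
    have hNp : 0 < N := hNpos _
    -- The point at distance `T` lies between the centre and the trial point, where the model has
    -- value at most `c`.
    have e1 : x (φ k) + T • d (φ k) = (1 - T / N) • x (φ k) + (T / N) • y (φ k) := by
      simp only [d, ← hNdef, smul_smul, div_eq_mul_inv]
      module
    have h0 : 0 ≤ T / N := by positivity
    have h1 : T / N ≤ 1 := (div_le_one hNp).2 hTk
    change g _ ≤ (c : EReal)
    rw [e1]
    refine (hp.le_of_jLe (jLe_model_combo h₀ _ _ _ h0 h1)).trans
      ((hp.combo_le (by simpa using hx (φ k)) (hy (φ k)) h0 h1).trans_eq ?_)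
    congr 1; ring
  obtain ⟨R, hR⟩ := (hH a (haF.trans_lt (EReal.coe_lt_top c))).exists_norm_le c
  have hR0 : 0 ≤ R := (norm_nonneg _).trans (hR _ (hray 0 le_rfl))
  have hb := hR _ (hray (R + ‖a‖ + 1) (by positivity))
  have h1 : ‖(R + ‖a‖ + 1) • e‖ = R + ‖a‖ + 1 := by
    rw [norm_smul, he, mul_one, Real.norm_of_nonneg (by positivity)]
  have h2 := norm_sub_le (a + (R + ‖a‖ + 1) • e) a
  rw [add_sub_cancel_left, h1] at h2
  linarith

/-- Step sizes above a uniform threshold always pass the acceptance test. -/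
lemma exists_threshold (hp : Problem F g J) {α₀ : Fin m → ℝ} (h₀ : α₀ ∈ stepSizes J)
    (hP : Coercive fun x => g (F x))
    (hH : ∀ x, F x ∈ dom g → Coercive fun y => g (model F α₀ x y)) (c : ℝ) :
    ∃ L : ℝ, 1 ≤ L ∧ ∀ x y, g (F x) ≤ c → g (model F α₀ x y) ≤ c →
      ∀ (α : Fin m → ℝ) i, L ≤ α i → F y i ≤ model F α x y i := by
  obtain ⟨R₀, hR₀⟩ := hP.exists_norm_le c
  obtain ⟨R₁, hR₁⟩ := hp.exists_norm_le_of_model_le h₀ hP hH c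
  choose K hK using fun i => ((hp.grad i).locallyLipschitzOn
    (s := Metric.closedBall (0 : E n) (max R₀ R₁))).exists_lipschitzOnWith_of_compact
      (isCompact_closedBall _ _)
  have hsum : ∀ i, (K i : ℝ) ≤ ∑ j, (K j : ℝ) := fun i =>
    Finset.single_le_sum (f := fun j => (K j : ℝ)) (fun j _ => (K j).2) (Finset.mem_univ i)
  -- The gradient inequality at `y` bounds the linearization error by `K i * ‖y - x‖ ^ 2`, hence the
  -- factor 2 against `α i / 2`. The sum serves all coordinates, and the added 1 keeps the
  -- logarithms of the upper bounds nonnegative.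
  refine ⟨1 + 2 * ∑ j, (K j : ℝ), ?_, fun x y hx hy α i hα => ?_⟩
  · have : 0 ≤ ∑ j, (K j : ℝ) := Finset.sum_nonneg fun j _ => (K j).2
    linarith
  have hxm : x ∈ Metric.closedBall (0 : E n) (max R₀ R₁) := by
    simpa using Or.inl (hR₀ x hx)
  have hym : y ∈ Metric.closedBall (0 : E n) (max R₀ R₁) := by
    simpa using Or.inr (hR₁ x y hx hy)
  have hconv := add_inner_le_of_convexOn (hp.convex i) (hp.hasGradientAt i y) x
  have hlip := (hK i).dist_le_mul y hym x hxm
  rw [dist_eq_norm, dist_eq_norm] at hlip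
  have hcs := real_inner_le_norm
    (gradient (comp F i) y - gradient (comp F i) x) (y - x)
  have hsq : ‖gradient (comp F i) y - gradient (comp F i) x‖ * ‖y - x‖ ≤
      (K i : ℝ) * ‖y - x‖ ^ 2 := by
    have := mul_le_mul_of_nonneg_right hlip (norm_nonneg (y - x))
    linarith
  have hαK : (K i : ℝ) * ‖y - x‖ ^ 2 ≤ α i / 2 * ‖y - x‖ ^ 2 :=
    mul_le_mul_of_nonneg_right (by linarith [hsum i]) (sq_nonneg _)
  rw [inner_sub_left] at hcs
  have hneg : inner ℝ (gradient (comp F i) y) (x - y) =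
      -inner ℝ (gradient (comp F i) y) (y - x) := by
    rw [← inner_neg_right, neg_sub]
  rw [hneg] at hconv
  simp only [comp] at hconv hcs hsq
  simp only [model_apply]
  linarith

end Problem

/-! ### Step size growth and termination -/

/-- Step sizes that the scheme can produce: admissible ones between `α₀` and `M`. -/
def BoundedSteps (J : Set (Fin m)) (α₀ M : Fin m → ℝ) : Set (Fin m → ℝ) :=
  {α | α ∈ stepSizes J ∧ (∀ i, α₀ i ≤ α i) ∧ ∀ i, α i ≤ M i}

/-- The potential that increases at each pass of the inner loop. -/
noncomputable def potential (α : Fin m → ℝ) : ℝ := ∑ i, Real.log (α i)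

lemma potential_le {J : Set (Fin m)} {α₀ M α : Fin m → ℝ} (hM : ∀ i, 1 ≤ M i)
    (hα : α ∈ BoundedSteps J α₀ M) : potential α ≤ ∑ i, Real.log (M i) := by
  refine Finset.sum_le_sum fun i _ => ?_
  by_cases hi : i ∈ J
  · exact Real.log_le_log (hα.1.1 i hi) (hα.2.2 i)
  -- Outside `J` the step size is 0 and contributes nothing, since `Real.log 0 = 0`.
  · simpa [hα.1.2 i hi] using Real.log_nonneg (hM i)

/-- A bounded sequence which at each step stays put or grows by at least `δ > 0` finally
stays put. -/
lemma eventually_not_add_le {u : ℕ → ℝ} {B δ : ℝ} (hδ : 0 < δ) (hB : ∀ k, u k ≤ B)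
    (hmono : Monotone u) : ∃ N, ∀ k ≥ N, ¬ u k + δ ≤ u (k + 1) := by
  have hlim := tendsto_atTop_ciSup hmono ⟨B, by rintro _ ⟨k, rfl⟩; exact hB k⟩
  have h1 := ((tendsto_add_atTop_iff_nat 1).2 hlim).sub hlim
  rw [sub_self] at h1
  obtain ⟨N, hN⟩ := eventually_atTop.1 (h1.eventually (gt_mem_nhds hδ))
  exact ⟨N, fun k hk hcon => by linarith [hN k hk]⟩

namespace Problem

variable {F : E n → E m} {g : E m → EReal} {J : Set (Fin m)}

lemma mem_of_violated (hp : Problem F g J) {α : Fin m → ℝ} (hα : α ∈ stepSizes J) {x y : E n}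
    {i : Fin m} (hi : model F α x y i < F y i) : i ∈ J := by
  by_contra hJ
  have := (hp.jLe_model_zero x y i).2 hJ
  simp only [model_apply, hα.2 i hJ, Pi.zero_apply] at hi this
  linarith

/-- A rejection multiplies at least one coordinate by `η`; every violated coordinate is in `J`,
where the logarithm of the product splits. -/
lemma potential_increase (hp : Problem F g J) {η : ℝ} (hη : 1 < η) {α : Fin m → ℝ}
    (hα : α ∈ stepSizes J) {x y : E n} (hacc : ¬ Accepts F x α y) :
    potential α + Real.log η ≤ potential (increase F η x α y) := by
  have hlog : 0 < Real.log η := Real.log_pos hη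
  have hterm : ∀ i, Real.log (increase F η x α y i) =
      Real.log (α i) + if model F α x y i < F y i then Real.log η else 0 := by
    intro i
    simp only [increase]
    split_ifs with hv
    · rw [Real.log_mul (by linarith) (hα.1 i (hp.mem_of_violated hα hv)).ne', add_comm]
    · simp
  simp only [Accepts, not_forall, not_le] at hacc
  obtain ⟨i, hi⟩ := hacc
  simp only [potential, hterm, Finset.sum_add_distrib]
  gcongr
  have := Finset.single_le_sum (f := fun i => if model F α x y i < F y i then Real.log η else 0)
    (fun j _ => by positivity) (Finset.mem_univ i)
  rwa [if_pos hi] at this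

end Problem

/-- `M` bounds the step sizes that the inner loop produces from points of the sublevel set at
height `c`, and the initial models are coercive. -/
structure Controlled (F : E n → E m) (g : E m → EReal) (J : Set (Fin m)) (η c : ℝ)
    (α₀ M : Fin m → ℝ) : Prop where
  initial : α₀ ∈ stepSizes J
  factor : 1 < η
  coercive : ∀ x, F x ∈ dom g → Coercive fun y => g (model F α₀ x y)
  one_le : ∀ i, 1 ≤ M i
  bound : ∀ x y, g (F x) ≤ c → g (model F α₀ x y) ≤ c →
    ∀ (α : Fin m → ℝ) i, model F α x y i < F y i → η * α i ≤ M i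

namespace Controlled

variable {F : E n → E m} {g : E m → EReal} {J : Set (Fin m)} {η c : ℝ} {α₀ M : Fin m → ℝ}

lemma increase_mem (hp : Problem F g J) (hc : Controlled F g J η c α₀ M) {α : Fin m → ℝ}
    (hα : α ∈ BoundedSteps J α₀ M) {x y : E n} (hx : g (F x) ≤ c) (hy : y ∈ subSol F g α x) :
    increase F η x α y ∈ BoundedSteps J α₀ M := by
  have hy0 : g (model F α₀ x y) ≤ c :=
    (hp.le_of_jLe (jLe_model_model hα.2.1 (fun i hi => by
      rw [hc.initial.2 i hi, hα.1.2 i hi]) x y)).trans ((Problem.le_of_mem_subSol hy).trans hx)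
  have hη := hc.factor
  refine ⟨⟨fun i hi => ?_, fun i hi => ?_⟩, fun i => ?_, fun i => ?_⟩ <;>
    simp only [increase] <;> split_ifs with hv
  · exact mul_pos (by linarith) (hα.1.1 i hi)
  · exact hα.1.1 i hi
  · exact absurd (hp.mem_of_violated hα.1 hv) hi
  · exact hα.1.2 i hi
  · have := hα.1.1 i (hp.mem_of_violated hα.1 hv)
    exact (hα.2.1 i).trans (le_mul_of_one_le_left this.le hη.le)
  · exact hα.2.1 i
  · exact hc.bound x y hx hy0 α i hv
  · exact hα.2.2 i

/-- States reachable by the inner loop started at step sizes `α`. -/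
lemma inner_invariant (hp : Problem F g J) (hc : Controlled F g J η c α₀ M) {α : Fin m → ℝ}
    (hα : α ∈ BoundedSteps J α₀ M) {x : E n} (hx : g (F x) ≤ c) {s₀ s : InnerState n m}
    (h₀ : InnerInit F g x α s₀) (hs : Relation.ReflTransGen (InnerStep F g η x) s₀ s) :
    s.1 ∈ BoundedSteps J α₀ M ∧ s.2 ∈ subSol F g s.1 x ∧
      (s.1 = α ∨ potential α + Real.log η ≤ potential s.1) := by
  induction hs with
  | refl => exact ⟨h₀.1 ▸ hα, h₀.1 ▸ h₀.2, Or.inl h₀.1⟩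
  | tail _ hstep ih =>
    obtain ⟨hrej, he, hsub⟩ := hstep
    have hpot := hp.potential_increase hc.factor ih.1.1 hrej
    refine ⟨he ▸ increase_mem hp hc ih.1 hx ih.2.1, hsub, Or.inr ?_⟩
    rw [he]
    have hlog : 0 < Real.log η := Real.log_pos hc.factor
    rcases ih.2.2 with h | h
    · rwa [h] at hpot ⊢
    · linarith

lemma not_infinite_inner (hp : Problem F g J) (hc : Controlled F g J η c α₀ M)
    {α : Fin m → ℝ} (hα : α ∈ BoundedSteps J α₀ M) {x : E n} (hx : g (F x) ≤ c) :
    ¬ ∃ s : ℕ → InnerState n m, InnerInit F g x α (s 0) ∧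
      ∀ j, InnerStep F g η x (s j) (s (j + 1)) := by
  rintro ⟨s, h0, hs⟩
  have hreach : ∀ j, Relation.ReflTransGen (InnerStep F g η x) (s 0) (s j) := fun j => by
    induction j with
    | zero => exact .refl
    | succ j ih => exact ih.tail (hs j)
  have hinv := fun j => inner_invariant hp hc hα hx h0 (hreach j)
  have hinc : ∀ j, potential (s j).1 + Real.log η ≤ potential (s (j + 1)).1 := fun j => by
    rw [(hs j).2.1]
    exact hp.potential_increase hc.factor (hinv j).1.1 (hs j).1
  have hlog : 0 < Real.log η := Real.log_pos hc.factor
  obtain ⟨N, hN⟩ := eventually_not_add_le (u := fun j => potential (s j).1) hlog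
    (fun j => potential_le hc.one_le (hinv j).1)
    (monotone_nat_of_le_succ fun j => by linarith [hinc j])
  exact hN N le_rfl (hinc N)

/-- When the scheme stays put, the current point is itself a minimizer and trivially accepted, so
both branches share the same properties. -/
lemma outer_step (hp : Problem F g J) (hc : Controlled F g J η c α₀ M)
    {p p' : E n × (Fin m → ℝ)} (hx : g (F p.1) ≤ c) (hα : p.2 ∈ BoundedSteps J α₀ M)
    (h : OuterStep F g η p p') :
    p'.2 ∈ BoundedSteps J α₀ M ∧ p'.1 ∈ subSol F g p'.2 p.1 ∧ Accepts F p.1 p'.2 p'.1 ∧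
      g (F p'.1) ≤ g (model F p'.2 p.1 p'.1) ∧
      (p'.2 = p.2 ∨ potential p.2 + Real.log η ≤ potential p'.2) := by
  obtain ⟨s₀, s, h0, hs, hacc, he, h1, h2⟩ := h
  obtain ⟨hb, hsub, hpot⟩ := inner_invariant hp hc hα hx h0 hs
  rw [← he] at hb hsub hpot hacc
  have key : p'.1 ∈ subSol F g p'.2 p.1 ∧ Accepts F p.1 p'.2 p'.1 := by
    by_cases hfix : p.1 ∈ subSol F g p'.2 p.1
    · rw [h1 hfix]
      exact ⟨hfix, fun i => by simp⟩
    · rw [h2 hfix]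
      exact ⟨hsub, hacc⟩
  exact ⟨hb, key.1, key.2, hp.le_of_jLe (hp.jLe_of_accepts hb.1 key.2), hpot⟩

lemma outer_invariant (hp : Problem F g J) (hc : Controlled F g J η c α₀ M)
    {x₀ : E n} (hx₀ : g (F x₀) ≤ c) (hM : α₀ ∈ BoundedSteps J α₀ M)
    {p : E n × (Fin m → ℝ)} (h : Relation.ReflTransGen (OuterStep F g η) (x₀, α₀) p) :
    g (F p.1) ≤ c ∧ p.2 ∈ BoundedSteps J α₀ M := by
  induction h with
  | refl => exact ⟨hx₀, hM⟩
  | tail _ hstep ih =>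
    obtain ⟨h1, h2, -, h4, -⟩ := outer_step hp hc ih.1 ih.2 hstep
    exact ⟨h4.trans ((Problem.le_of_mem_subSol h2).trans ih.1), h1⟩

end Controlled

/-! ### Convergence of the iterates -/

namespace Problem

variable {F : E n → E m} {g : E m → EReal} {J : Set (Fin m)}

/-- Convergence of the method with fixed step sizes. -/
lemma exists_tendsto_of_fixed_steps (hp : Problem F g J)
    (hP : Coercive fun x => g (F x))
    {α : Fin m → ℝ} (hα : α ∈ stepSizes J) {x : ℕ → E n} (hx0 : F (x 0) ∈ dom g)
    (hsub : ∀ k, x (k + 1) ∈ subSol F g α (x k)) (hacc : ∀ k, Accepts F (x k) α (x (k + 1)))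
    (hstay : ∀ k, x k ∈ subSol F g α (x k) → x (k + 1) = x k) :
    ∃ xs ∈ argmin fun x => g (F x), Tendsto x atTop (𝓝 xs) := by
  have hdesc : ∀ k, g (F (x (k + 1))) ≤ g (model F α (x k) (x (k + 1))) := fun k =>
    hp.le_of_jLe (hp.jLe_of_accepts hα (hacc k))
  have hanti : Antitone fun k => g (F (x k)) :=
    antitone_nat_of_succ_le fun k => (hdesc k).trans (le_of_mem_subSol (hsub k))
  have hdom : ∀ k, F (x k) ∈ dom g := fun k => (hanti (Nat.zero_le k)).trans_lt hx0
  by_cases hS : ∃ k, x k ∈ argmin fun x => g (F x)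
  · obtain ⟨N, hN⟩ := hS
    refine ⟨x N, hN, tendsto_const_nhds.congr' ?_⟩
    filter_upwards [eventually_ge_atTop N] with k hk
    induction k, hk using Nat.le_induction with
    | base => rfl
    | succ k _ ih =>
      rw [ih]
      exact (hstay k ((hp.mem_subSol_self_iff hα (hdom k)).2 (ih ▸ hN))).symm
  push Not at hS
  have hfejer : ∀ xs ∈ argmin fun x => g (F x), Antitone fun k => dist (x k) xs := fun xs hxs =>
    antitone_nat_of_succ_le fun k =>
      (hp.mem_argmin_or_dist_le hα (hsub k) (hacc k) hxs).resolve_left (hS _)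
  obtain ⟨c, hc⟩ := hp.exists_real hx0
  have hle : ∀ k, g (F (x k)) ≤ c := fun k => (hanti (Nat.zero_le k)).trans hc.le
  obtain ⟨R, hR⟩ := hP.exists_norm_le c
  obtain ⟨a, -, φ, hφ, hlim⟩ := (isCompact_closedBall (0 : E n) R).tendsto_subseq (x := x)
    fun k => by simpa using hR _ (hle k)
  have ha : F a ∈ dom g :=
    lt_of_le_of_lt ((hp.lsc_comp.isClosed_preimage c).mem_of_tendsto hlim
      (Eventually.of_forall fun k => hle _)) (EReal.coe_lt_top c)
  have haS : a ∈ argmin fun x => g (F x) := by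
    refine ⟨ha, fun y => ?_⟩
    by_contra! hlt
    -- If `a` were not optimal, some `w` would improve the model at `a` strictly; by continuity it
    -- does so at an iterate near `a`, pushing all later values below some `r < g (F a)`, which
    -- lower semicontinuity forbids.
    obtain ⟨w, hw, hwlt⟩ := hp.exists_model_lt α ha
      ((hp.le_of_jLe (hp.jLe_model_zero a y)).trans_lt hlt)
    obtain ⟨r, hr, hra⟩ := EReal.lt_iff_exists_real_btwn.1 hwlt
    have hcont : Tendsto (fun k => model F α (x (φ k)) w) atTop (𝓝 (model F α a w)) :=
      ((hp.continuous_model α).tendsto (a, w)).comp (hlim.prodMk_nhds tendsto_const_nhds)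
    obtain ⟨k, hk⟩ := (hcont.eventually (hp.eventually_lt hw hr)).exists
    have hfin : g (F (x (φ k + 1))) ≤ r := (hdesc _).trans (((hsub _).2 w).trans hk.le)
    refine hra.not_ge ((hp.lsc_comp.isClosed_preimage (r : EReal)).mem_of_tendsto hlim ?_)
    filter_upwards [eventually_ge_atTop (φ k + 1)] with j hj
    exact (hanti (hj.trans (hφ.id_le j))).trans hfin
  refine ⟨a, haS, ?_⟩
  rw [Metric.tendsto_atTop]
  intro ε hε
  obtain ⟨k, hk⟩ := ((Metric.tendsto_nhds.1 hlim) ε hε).exists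
  exact ⟨φ k, fun j hj => (hfejer a haS hj).trans_lt hk⟩

end Problem

namespace Controlled

variable {F : E n → E m} {g : E m → EReal} {J : Set (Fin m)} {η c : ℝ} {α₀ M : Fin m → ℝ}

lemma exists_tendsto (hp : Problem F g J) (hc : Controlled F g J η c α₀ M)
    (hP : Coercive fun x => g (F x))
    {x₀ : E n} (hx₀ : g (F x₀) ≤ c) (hM : α₀ ∈ BoundedSteps J α₀ M)
    {x : ℕ → E n} {α : ℕ → Fin m → ℝ} (h : IsGenerated F g η x₀ α₀ x α) :
    ∃ xs ∈ argmin fun x => g (F x), Tendsto x atTop (𝓝 xs) := by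
  obtain ⟨h0, h1, hstep⟩ := h
  have hreach : ∀ k, Relation.ReflTransGen (OuterStep F g η) (x₀, α₀) (x k, α k) := fun k => by
    induction k with
    | zero => rw [h0, h1]
    | succ k ih => exact ih.tail (hstep k)
  have hinv := fun k => outer_invariant hp hc hx₀ hM (hreach k)
  have hout := fun k => outer_step hp hc (hinv k).1 (hinv k).2 (hstep k)
  have hlog : 0 < Real.log η := Real.log_pos hc.factor
  obtain ⟨N, hN⟩ := eventually_not_add_le (u := fun k => potential (α k)) hlog
    (fun k => potential_le hc.one_le (hinv k).2) (monotone_nat_of_le_succ fun k => by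
      rcases (hout k).2.2.2.2 with h | h
      · exact (congrArg potential h).ge
      · exact le_trans (by linarith) h)
  have hconst : ∀ k, α (N + k) = α N := fun k => by
    induction k with
    | zero => rfl
    | succ k ih =>
      exact ((hout (N + k)).2.2.2.2.resolve_right (hN _ (Nat.le_add_right N k))).trans ih
  -- The step from `x (N + k)` uses the updated sizes `α (N + k + 1)`, hence the shift.
  have hαs : ∀ k, α (N + k + 1) = α N := fun k => hconst (k + 1)
  obtain ⟨xs, hxs, hlim⟩ := hp.exists_tendsto_of_fixed_steps hP (hinv N).2.1
    (x := fun k => x (N + k)) ((hinv N).1.trans_lt (EReal.coe_lt_top c))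
    (fun k => hαs k ▸ (hout (N + k)).2.1) (fun k => hαs k ▸ (hout (N + k)).2.2.1)
    (fun k hk => by
      obtain ⟨_, _, _, _, _, _, hfix, _⟩ := hstep (N + k)
      exact hfix (by simpa only [hαs k] using hk))
  refine ⟨xs, hxs, (tendsto_add_atTop_iff_nat N).1 ?_⟩
  simpa only [add_comm] using hlim

end Controlled

end Multiprox

theorem mainTheorem12 {n m : ℕ}
    (F : Multiprox.E n → Multiprox.E m) (g : Multiprox.E m → EReal) (J : Set (Fin m))
    -- the components of `F`
    (hF_smooth : ∀ i, ContDiff ℝ 1 (Multiprox.comp F i))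
    (hF_convex : ∀ i, ConvexOn ℝ Set.univ (Multiprox.comp F i))
    (hF_grad : ∀ i, LocallyLipschitz (gradient (Multiprox.comp F i)))
    (hF_affine : ∀ i ∉ J, Multiprox.IsAffine (Multiprox.comp F i))
    -- the outer function `g`
    (hg_proper : Multiprox.Proper g)
    (hg_convex : Multiprox.ConvexFun g)
    (hg_lsc : LowerSemicontinuous g)
    (hg_lip : Multiprox.LipschitzOnDom g)
    (hg_mono : ∀ i ∈ J, Multiprox.NondecreasingIn g i)
    -- the problem is proper and has a minimizer
    (hP_proper : Multiprox.Proper fun x => g (F x))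
    (hP_min : (Multiprox.argmin fun x => g (F x)).Nonempty)
    -- qualification
    (hQ : ∃ xbar, F xbar ∈ interior (Multiprox.dom g))
    -- parameters of the algorithm
    (x₀ : Multiprox.E n) (hx₀ : F x₀ ∈ Multiprox.dom g)
    (α₀ : Fin m → ℝ) (hα₀ : α₀ ∈ Multiprox.stepSizes J)
    (η : ℝ) (hη : 1 < η)
    -- coercivity of the problem and of the initial models
    (hP_coercive : Multiprox.Coercive fun x => g (F x))
    (hH_coercive : ∀ x, F x ∈ Multiprox.dom g →
      Multiprox.Coercive fun y => g (Multiprox.model F α₀ x y)) :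
    -- at each outer state the scheme can reach, it is well defined and the inner loop is finite
    (∀ (x : Multiprox.E n) (α : Fin m → ℝ),
      Relation.ReflTransGen (Multiprox.OuterStep F g η) (x₀, α₀) (x, α) →
        F x ∈ Multiprox.dom g ∧
        (Multiprox.subSol F g α x).Nonempty ∧
        (∀ s₀ s : Multiprox.InnerState n m, Multiprox.InnerInit F g x α s₀ →
          Relation.ReflTransGen (Multiprox.InnerStep F g η x) s₀ s →
          ¬ Multiprox.Accepts F x s.1 s.2 →
          (Multiprox.subSol F g (Multiprox.increase F η x s.1 s.2) x).Nonempty) ∧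
        ¬ ∃ s : ℕ → Multiprox.InnerState n m,
          Multiprox.InnerInit F g x α (s 0) ∧
          ∀ j, Multiprox.InnerStep F g η x (s j) (s (j + 1))) ∧
    -- every generated sequence converges to a solution
    (∀ (x : ℕ → Multiprox.E n) (α : ℕ → Fin m → ℝ),
      Multiprox.IsGenerated F g η x₀ α₀ x α →
        ∃ xstar ∈ Multiprox.argmin fun x => g (F x),
          Filter.Tendsto x Filter.atTop (nhds xstar)) := by
  have hp : Multiprox.Problem F g J :=
    ⟨hF_smooth, hF_convex, hF_grad, hF_affine, hg_proper, hg_convex, hg_lsc, hg_lip, hg_mono, hQ⟩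
  obtain ⟨c, hcx⟩ := hp.exists_real hx₀
  obtain ⟨L, hL1, hL⟩ := hp.exists_threshold hα₀ hP_coercive hH_coercive c
  -- A violated coordinate is below `L`, so its increase stays below `η * L`; an initial size
  -- already larger is covered by `α₀ i`.
  let M : Fin m → ℝ := fun i => max (α₀ i) (η * L)
  have hM : α₀ ∈ Multiprox.BoundedSteps J α₀ M :=
    ⟨hα₀, fun i => le_rfl, fun i => le_max_left _ _⟩
  have hc : Multiprox.Controlled F g J η c α₀ M := by
    refine ⟨hα₀, hη, hH_coercive, fun i => le_max_of_le_right ?_, fun x y hx hy α i hv => ?_⟩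
    · exact one_le_mul_of_one_le_of_one_le hη.le hL1
    · refine le_max_of_le_right (mul_le_mul_of_nonneg_left ?_ (by linarith))
      by_contra! hlt
      exact hv.not_ge (hL x y hx hy α i hlt.le)
  refine ⟨fun x α hreach => ?_, fun x α hgen =>
    hc.exists_tendsto hp hP_coercive hcx.le hM hgen⟩
  obtain ⟨hx, hα⟩ := hc.outer_invariant hp hcx.le hM hreach
  have hxd : F x ∈ Multiprox.dom g := hx.trans_lt (EReal.coe_lt_top c)
  refine ⟨hxd, hp.subSol_nonempty hα₀ hα.1 hα.2.1 hxd (hH_coercive x hxd),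
    fun s₀ s h₀ hs _ => ?_, hc.not_infinite_inner hp hα hx⟩
  obtain ⟨hs1, hs2, -⟩ := hc.inner_invariant hp hα hx h₀ hs
  have hinc := hc.increase_mem hp hs1 hx hs2
  exact hp.subSol_nonempty hα₀ hinc.1 hinc.2.1 hxd (hH_coercive x hxd)
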